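/- Model. There are $k$ peers with IDs and a source holding $X\in\{0,1\}^n$, where $1\le k\le n$ and $n\ge 2$. Time is divided into synchronous rounds. In each round every peer generates fresh independent unbiased random bits, queries a set of indices of $X$, receives the corresponding bits of $X$ from the source, and then sends to each peer a (possibly different) bit string; the recipient sees who sent it. A *dynamic Byzantine adversary* with parameter $\beta\in[0,1)$ chooses, at the start of each round, an arbitrary new set of at most $\beta k$ faulty peers for that round, knowing the protocol, $X$, and all random bits and communication of the earlier rounds. It dictates the messages sent by the faulty peers of the round and the local memory with which they are left after it; for this it may use the random bits of the current round as well. Messages are always delivered; a peer that is faulty in one round and nonfaulty in the next then follows the protocol, using the messages actually delivered to it. Put $\gamma=1-\beta$. A protocol, which may depend on $n,k,\beta$, *solves Download* in an execution if, on termination, every peer that is nonfaulty in the last round outputs $X$. Theorem. For every $c\ge 1$ there is a constant $C>0$ depending only on $c$ such that for all $n\ge 2$, $1\le k\le n$ and $\beta\in[0,1)$ there is a randomized protocol in this point-to-point model that stops after at most $C\log n$ rounds and such that, for every $X\in\{0,1\}^n$ and every dynamic Byzantine adversary with parameter $\beta$: 1. with probability at least $1-n^{-c}$ the protocol solves Download;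 2. for every peer, the expected number of queries that it makes in the rounds in which it is nonfaulty is at most $C\,\frac{n}{\gamma k}\log n$; 3. in every execution, every message sent by a peer that is nonfaulty in the round of sending has at most $Cn$ bits. -/

import Mathlib

namespace DataRetrieval

/-- A bit string sent over one link in one round; its size is its length, and the empty string
means that nothing is sent. -/
abbrev Msg : Type := List Bool

/-- A synchronous randomized point-to-point protocol for `k` peers and an `n`-bit source.
In each round `t` a nonfaulty peer looks at its ID, its state, the messages that were delivered to
it in the previous round (indexed by their sender) and its fresh random bits, and chooses the
indices to query. After the source has answered, it chooses one message per receiver and its new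
state. The entry of a peer's message vector at its own ID is merely local memory. -/
structure Protocol (n k : ℕ) where
  /-- The number of rounds after which the protocol stops. -/
  rounds : ℕ
  /-- The number of random bits that each peer generates per round. -/
  numBits : ℕ
  State : Type
  init : Fin k → State
  /-- The set of indices that the peer queries. -/
  query : (t : ℕ) → (p : Fin k) → State → (Fin k → Msg) → (Fin numBits → Bool) → Finset (Fin n)
  /-- The messages and the new state. The last argument is the response of the source:
  `some` bit at the queried indices, `none` elsewhere. -/
  act : (t : ℕ) → (p : Fin k) → State → (Fin k → Msg) → (Fin numBits → Bool) →
    (Fin n → Option Bool) → (Fin k → Msg) × State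
  /-- The array that a peer outputs on termination. -/
  output : State → (Fin n → Bool)

variable {n k : ℕ}

/-- The random bits of all peers in the first `t` rounds. -/
abbrev Protocol.Coins (P : Protocol n k) (t : ℕ) : Type :=
  Fin t → Fin k → Fin P.numBits → Bool

/-- The response of the source with content `X` to the set `Q` of queries. -/
def answer (X : Fin n → Bool) (Q : Finset (Fin n)) : Fin n → Option Bool :=
  fun i => if i ∈ Q then some (X i) else none

/-- A strategy of the dynamic Byzantine adversary. At the start of each round it selects a new set
of at most `β k` corrupted peers, knowing all random bits of the earlier rounds; these, with the
source and the strategy itself, determine all earlier communication. It then dictates the messages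
of the corrupted peers and the memory they are left with, and here it may even use the random bits
of the current round. -/
structure Adversary (P : Protocol n k) (β : ℝ) where
  corrupt : (t : ℕ) → P.Coins t → Finset (Fin k)
  card_corrupt_le : ∀ t h, ((corrupt t h).card : ℝ) ≤ β * k
  /-- `send t h p q` is the message from the corrupted peer `p` to `q` in round `t`. -/
  send : (t : ℕ) → P.Coins (t + 1) → Fin k → Fin k → Msg
  newState : (t : ℕ) → P.Coins (t + 1) → Fin k → P.State

/-- The global configuration after some number of rounds, with cost counters. -/
structure Config (P : Protocol n k) where
  state : Fin k → P.State
  /-- `inbox p q` is the message from `q` delivered to `p` in the last round. -/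
  inbox : Fin k → Fin k → Msg
  /-- The peers that were corrupted in the last round. -/
  faulty : Finset (Fin k)
  /-- The number of queries that each peer has made in the rounds in which it was nonfaulty. -/
  queries : Fin k → ℕ
  /-- The maximum size of a message sent so far by a peer nonfaulty in the round of sending. -/
  msgSize : ℕ

/-- The configuration before the first round. -/
def Config.initial (P : Protocol n k) : Config P where
  state := P.init
  inbox := fun _ _ => []
  faulty := ∅
  queries := fun _ => 0
  msgSize := 0

/-- One round: `t` is the number of the round, `B` the set of corrupted peers, `r` the random bits
of this round, `badMsg` and `badState` are the messages and new states of corrupted peers. -/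
def Config.step {P : Protocol n k} (X : Fin n → Bool) (t : ℕ) (B : Finset (Fin k))
    (r : Fin k → Fin P.numBits → Bool) (badMsg : Fin k → Fin k → Msg)
    (badState : Fin k → P.State) (c : Config P) : Config P :=
  let Q : Fin k → Finset (Fin n) := fun p => P.query t p (c.state p) (c.inbox p) (r p)
  let A : Fin k → (Fin k → Msg) × P.State := fun p =>
    P.act t p (c.state p) (c.inbox p) (r p) (answer X (Q p))
  { state := fun p => if p ∈ B then badState p else (A p).2
    inbox := fun p q => if q ∈ B then badMsg q p else (A q).1 p
    faulty := B
    queries := fun p => if p ∈ B then c.queries p else c.queries p + (Q p).card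
    msgSize := max c.msgSize
      (Bᶜ.sup fun p => Finset.univ.sup fun q => ((A p).1 q).length) }

/-- The configuration after `t` rounds with random bits `ω`, on the source content `X`. -/
def exec (P : Protocol n k) {β : ℝ} (X : Fin n → Bool) (Adv : Adversary P β) :
    (t : ℕ) → P.Coins t → Config P
  | 0, _ => Config.initial P
  | t + 1, ω =>
    (exec P X Adv t (Fin.init ω)).step X t (Adv.corrupt t (Fin.init ω)) (ω (Fin.last t))
      (Adv.send t ω) (Adv.newState t ω)

/-- The configuration on termination. -/
def final (P : Protocol n k) {β : ℝ} (X : Fin n → Bool) (Adv : Adversary P β)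
    (ω : P.Coins P.rounds) : Config P :=
  exec P X Adv P.rounds ω

/-- Download succeeds: on termination every nonfaulty peer outputs the whole source. As the set of
corrupted peers varies, the nonfaulty peers are those not corrupted in the last round. -/
def Succeeds (P : Protocol n k) {β : ℝ} (X : Fin n → Bool) (Adv : Adversary P β)
    (ω : P.Coins P.rounds) : Prop :=
  ∀ p, p ∉ (final P X Adv ω).faulty → P.output ((final P X Adv ω).state p) = X

/-- The probability of success; all random bits are independent and unbiased. -/
noncomputable def successProb (P : Protocol n k) {β : ℝ} (X : Fin n → Bool)
    (Adv : Adversary P β) : ℝ :=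
  (Nat.card {ω : P.Coins P.rounds // Succeeds P X Adv ω} : ℝ) / Nat.card (P.Coins P.rounds)

/-- The expected number of queries made by peer `p` in the rounds in which it is nonfaulty. -/
noncomputable def expectedQueries (P : Protocol n k) {β : ℝ} (X : Fin n → Bool)
    (Adv : Adversary P β) (p : Fin k) : ℝ :=
  (∑ ω : P.Coins P.rounds, ((final P X Adv ω).queries p : ℝ)) / Nat.card (P.Coins P.rounds)

end DataRetrieval

namespace DataRetrieval

open Finset

/-! Indices are grouped by their `m` lowest binary digits into `2 ^ m` segments of level `m`; each
is the union of two of level `m + 1`. Round `t` works at level `m = d - t`: every nonfaulty peer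
determines a random segment and broadcasts its content. The faulty set is fixed before the bits of
the round are drawn, so a Chernoff bound and a union bound over segments (`card_few_hits_le`,
`card_not_covered_le`) give each segment at least half of the `γ k / 2 ^ m` correct claims expected.
A receiver keeps only claims with that much support. The truth is then among them, and reading a
separator singles it out (`exists_separator`, `resolve_eq`). This climbs to level 0, the whole
source. Decisions use only the inbox and fresh bits, so corrupted memory is harmless.

A sender supports one claim per round, so at most `2 ^ (m + 1) / γ` candidates exist over all
segments together. A random segment of level `m - 1` meets on average `4 / γ` of them, whatever was
sent (`sum_card_roundQuery_le`). `exists_levels` chooses `d` so that the segments read in full in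
round 0 are small, yet, unless `d = 0`, of order `log n` nonfaulty peers are expected on each. -/

/-! ### Separating sets of positions -/

/-- Finitely many bit strings can be told apart by reading at most as many positions. -/
theorem exists_separator {ι : Type*} [DecidableEq ι] (S : Finset (ι → Bool)) :
    ∃ Q : Finset ι, Q.card ≤ S.card ∧
      ∀ s ∈ S, ∀ s' ∈ S, (∀ i ∈ Q, s i = s' i) → s = s' := by
  classical
  induction S using Finset.induction_on with
  | empty => exact ⟨∅, by simp⟩
  | insert s S hs ih =>
    obtain ⟨Q, hQ, hsep⟩ := ih
    by_cases h : ∃ s' ∈ S, ∀ i ∈ Q, s i = s' i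
    · obtain ⟨s', hs', hagree⟩ := h
      have hne : s ≠ s' := fun h => hs (h ▸ hs')
      obtain ⟨j, hj⟩ := Function.ne_iff.mp hne
      have key : ∀ u ∈ S, ¬ ∀ i ∈ insert j Q, s i = u i := by
        intro u hu hsu
        have : s' = u := hsep s' hs' u hu fun i hi =>
          (hagree i hi).symm.trans (hsu i (mem_insert_of_mem hi))
        exact hj ((hsu j (mem_insert_self _ _)).trans (congrFun this j).symm)
      refine ⟨insert j Q, ?_, ?_⟩
      · rw [card_insert_of_notMem hs]
        exact (card_insert_le _ _).trans (by omega)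
      · intro a ha b hb hab
        rcases mem_insert.mp ha with rfl | ha' <;> rcases mem_insert.mp hb with rfl | hb'
        · rfl
        · exact absurd hab (key b hb')
        · exact absurd (fun i hi => (hab i hi).symm) (key a ha')
        · exact hsep a ha' b hb' fun i hi => hab i (mem_insert_of_mem hi)
    · push Not at h
      refine ⟨Q, ?_, ?_⟩
      · rw [card_insert_of_notMem hs]; omega
      · intro a ha b hb hab
        rcases mem_insert.mp ha with rfl | ha' <;> rcases mem_insert.mp hb with rfl | hb'
        · rfl
        · obtain ⟨i, hi, hne⟩ := h b hb'
          exact absurd (hab i hi) hne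
        · obtain ⟨i, hi, hne⟩ := h a ha'
          exact absurd (hab i hi).symm hne
        · exact hsep a ha' b hb' hab

/-- A set of at most `S.card` positions that tells the strings of `S` apart. -/
noncomputable def separator {ι : Type*} [DecidableEq ι] (S : Finset (ι → Bool)) : Finset ι :=
  (exists_separator S).choose

theorem card_separator_le {ι : Type*} [DecidableEq ι] (S : Finset (ι → Bool)) :
    (separator S).card ≤ S.card :=
  (exists_separator S).choose_spec.1

open Classical in
/-- The string of `S` that agrees with `y` on the separator of `S`, if there is one. -/
noncomputable def resolve {ι : Type*} [DecidableEq ι] (S : Finset (ι → Bool)) (y : ι → Bool) :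
    ι → Bool :=
  if h : ∃ s ∈ S, ∀ i ∈ separator S, s i = y i then h.choose else fun _ => false

theorem resolve_eq {ι : Type*} [DecidableEq ι] {S : Finset (ι → Bool)} {x y : ι → Bool}
    (hx : x ∈ S) (hxy : ∀ i ∈ separator S, x i = y i) : resolve S y = x := by
  have h : ∃ s ∈ S, ∀ i ∈ separator S, s i = y i := ⟨x, hx, hxy⟩
  rw [resolve, dif_pos h]
  exact (exists_separator S).choose_spec.2 _ h.choose_spec.1 _ hx fun i hi =>
    (h.choose_spec.2 i hi).trans (hxy i hi).symm

/-! ### Segments and their names -/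

variable {n k d : ℕ}

/-- The first `m` bits of `r`, padded with `false`. The masked vectors are the names of the `2 ^ m`
segments of level `m`. -/
def mask (m : ℕ) (r : Fin d → Bool) : Fin d → Bool := fun b => decide (b.1 < m) && r b

/-- The lowest `d` binary digits of an index. -/
def label (d : ℕ) (i : Fin n) : Fin d → Bool := fun b => i.1.testBit b

/-- The string `x`, set to `false` outside the segment of level `m` with name `v`. -/
def restrictTo (m : ℕ) (v : Fin d → Bool) (x : Fin n → Bool) : Fin n → Bool :=
  fun i => if mask m (label d i) = v then x i else false

/-- The claim that the segment `v` has the content `s`, as a message. -/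
def encode (v : Fin d → Bool) (s : Fin n → Bool) : Msg := List.ofFn v ++ List.ofFn s

theorem length_encode (v : Fin d → Bool) (s : Fin n → Bool) : (encode v s).length = d + n := by
  simp [encode]

theorem encode_inj {v v' : Fin d → Bool} {s s' : Fin n → Bool} (h : encode v s = encode v' s') :
    v = v' ∧ s = s' := by
  obtain ⟨h₁, h₂⟩ := List.append_inj h (by simp)
  exact ⟨List.ofFn_injective h₁, List.ofFn_injective h₂⟩

theorem mask_mask_of_le {m m' : ℕ} (h : m ≤ m') (r : Fin d → Bool) :
    mask m (mask m' r) = mask m r := by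
  funext b
  simp only [mask]
  by_cases hb : b.1 < m
  · simp [hb, hb.trans_le h]
  · simp [hb]

theorem mask_zero (r r' : Fin d → Bool) : mask 0 r = mask 0 r' := by
  funext b
  simp [mask]

theorem mask_self (r : Fin d → Bool) : mask d r = r := by
  funext b
  simp [mask]

theorem restrictTo_restrictTo (m : ℕ) (v : Fin d → Bool) (x : Fin n → Bool) :
    restrictTo m v (restrictTo m v x) = restrictTo m v x := by
  funext i
  simp only [restrictTo]
  split_ifs <;> rfl

theorem card_filter_mask_eq {m : ℕ} (hm : m ≤ d) {v : Fin d → Bool} (hv : mask m v = v) :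
    (univ.filter fun r : Fin d → Bool => mask m r = v).card = 2 ^ (d - m) := by
  have : (univ.filter fun r : Fin d → Bool => mask m r = v) =
      Fintype.piFinset fun b : Fin d => if b.1 < m then {v b} else univ := by
    ext r
    simp only [mem_filter, mem_univ, true_and, Fintype.mem_piFinset]
    constructor
    · rintro rfl b
      split_ifs with hb <;> simp [mask, hb]
    · intro h
      funext b
      have := h b
      split_ifs at this with hb
      · simpa [mask, hb] using this
      · rw [← hv]; simp [mask, hb]
  rw [this, Fintype.card_piFinset]
  have : ∀ b : Fin d, (if b.1 < m then ({v b} : Finset Bool) else univ).card =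
      if b.1 < m then 1 else 2 := by
    intro b; split_ifs <;> simp
  simp only [this]
  rw [Fin.prod_univ_eq_prod_range (fun b => if b < m then 1 else 2) d,
    ← Finset.prod_range_mul_prod_Ico _ hm]
  rw [Finset.prod_eq_one, Finset.prod_congr rfl (g := fun _ => 2)]
  · simp
  · intro b hb; simp only [mem_Ico] at hb; simp [hb.1]
  · intro b hb; simp only [mem_range] at hb; simp [hb]

/-- Indices with the same `d` lowest digits are told apart by their quotients by `2 ^ d`. -/
theorem card_filter_label_le (r : Fin d → Bool) :
    (univ.filter fun i : Fin n => label d i = r).card ≤ n / 2 ^ d + 1 := by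
  rw [← card_range (n / 2 ^ d + 1)]
  apply card_le_card_of_injOn (fun i : Fin n => i.1 / 2 ^ d)
  · intro i _
    simp only [coe_range, Set.mem_Iio]
    exact Nat.lt_succ_of_le (Nat.div_le_div_right i.2.le)
  · intro i hi j hj hij
    simp only [coe_filter, mem_univ, true_and, Set.mem_ofPred_eq] at hi hj
    have hmod : i.1 % 2 ^ d = j.1 % 2 ^ d := by
      apply Nat.eq_of_testBit_eq
      intro b
      rw [Nat.testBit_mod_two_pow, Nat.testBit_mod_two_pow]
      by_cases hb : b < d
      · have := congrFun (hi.trans hj.symm) ⟨b, hb⟩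
        simp only [label] at this
        rw [this]
      · simp [hb]
    apply Fin.ext
    rw [← Nat.div_add_mod i.1 (2 ^ d), ← Nat.div_add_mod j.1 (2 ^ d), hmod]
    simp only at hij
    rw [hij]

/-! ### Claims, the protocol and its invariant -/

/-- The contents of segment `v` of level `m` that at least `τ` messages claim. -/
noncomputable def candidates (m : ℕ) (τ : ℝ) (inb : Fin k → Msg) (v : Fin d → Bool) :
    Finset (Fin n → Bool) :=
  univ.filter fun s => restrictTo m v s = s ∧
    τ ≤ ((univ.filter fun q => inb q = encode v s).card : ℝ)

/-- As every message supports a single claim, few claims have much support. -/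
theorem sum_card_candidates_mul_le (m : ℕ) (τ : ℝ) (inb : Fin k → Msg) :
    (∑ v : Fin d → Bool, ((candidates (n := n) m τ inb v).card : ℝ)) * τ ≤ k := by
  have h₁ : ∀ v : Fin d → Bool, ((candidates (n := n) m τ inb v).card : ℝ) * τ ≤
      ∑ s : Fin n → Bool, ((univ.filter fun q => inb q = encode v s).card : ℝ) := by
    intro v
    calc ((candidates (n := n) m τ inb v).card : ℝ) * τ
        = ∑ s ∈ candidates (n := n) m τ inb v, τ := by simp
      _ ≤ ∑ s ∈ candidates (n := n) m τ inb v,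
          ((univ.filter fun q => inb q = encode v s).card : ℝ) :=
        sum_le_sum fun s hs => (mem_filter.mp hs).2.2
      _ ≤ _ := sum_le_sum_of_subset_of_nonneg (subset_univ _) fun _ _ _ => by positivity
  rw [sum_mul]
  refine (sum_le_sum fun v _ => h₁ v).trans ?_
  rw [← Fintype.sum_prod_type'
    (f := fun v s => ((univ.filter fun q => inb q = encode v s).card : ℝ))]
  rw [← Nat.cast_sum, Nat.cast_le]
  rw [← card_biUnion]
  · exact (card_le_univ _).trans (by simp)
  · intro x _ y _ hxy
    refine Finset.disjoint_left.mpr fun q hq hq' => hxy ?_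
    simp only [mem_filter, mem_univ, true_and] at hq hq'
    obtain ⟨h, h'⟩ := encode_inj (hq.symm.trans hq')
    exact Prod.ext h h'

/-- The queries of round `t`: first a whole segment of level `d`, and then what it takes to find out
the content of a segment of level `d - t` from the claims on its subsegments. -/
noncomputable def roundQuery (γ : ℝ) : ℕ → (Fin k → Msg) → (Fin d → Bool) → Finset (Fin n)
  | 0, _, r => univ.filter fun i => label d i = r
  -- Here `v` also runs over strings that name no segment of level `d - t`. The bound on the total
  -- number of candidates covers these as well.
  | t + 1, inb, r => (univ.filter fun v : Fin d → Bool =>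
      mask (d - (t + 1)) r = mask (d - (t + 1)) v).biUnion fun v =>
        separator (candidates (d - t) (γ * k / 2 ^ (d - t + 1)) inb v)

/-- What a peer takes in round `t` for the content of the source, given the responses `y`, before
the restriction to its segment of level `d - t`. -/
noncomputable def recovered (γ : ℝ) : ℕ → (Fin k → Msg) → (d : ℕ) → (Fin n → Bool) → Fin n → Bool
  | 0, _, _, y => y
  | t + 1, inb, d, y => fun i =>
      resolve (candidates (d - t) (γ * k / 2 ^ (d - t + 1)) inb (mask (d - t) (label d i)))
        (restrictTo (d - t) (mask (d - t) (label d i)) y) i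

/-- In round `t` each peer determines the content of a random segment of level `d - t`, which it
sends to all peers. -/
noncomputable abbrev download (n k d : ℕ) (γ : ℝ) : Protocol n k where
  rounds := d + 1
  numBits := d
  State := Fin n → Bool
  init := fun _ _ => false
  query := fun t _ _ inb r => roundQuery γ t inb r
  act := fun t _ _ inb r ans =>
    -- The default `false` never affects the peer's own segment: there only queried positions are
    -- consulted.
    let s := restrictTo (d - t) (mask (d - t) r) (recovered γ t inb d fun i => (ans i).getD false)
    (fun _ => encode (mask (d - t) r) s, s)
  output := fun s => s

/-- The claims that were sent in the round before round `t` let every peer recover all segments. -/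
def Supported (d : ℕ) (γ : ℝ) (X : Fin n → Bool) (inbox : Fin k → Fin k → Msg) : ℕ → Prop
  | 0 => True
  | t + 1 => ∀ v : Fin d → Bool, mask (d - t) v = v → ∀ q, γ * k / 2 ^ (d - t + 1) ≤
      ((univ.filter fun p => inbox q p = encode v (restrictTo (d - t) v X)).card : ℝ)

/-- Each index of the peer's segment lies in a subsegment whose true content is a candidate and
whose separator has been queried, so `resolve_eq` applies. Bits outside the segment are discarded.
-/
theorem restrictTo_recovered {γ : ℝ} {X : Fin n → Bool} {inbox : Fin k → Fin k → Msg} {t : ℕ}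
    (h : Supported d γ X inbox t) (p : Fin k) (r : Fin d → Bool) :
    restrictTo (d - t) (mask (d - t) r) (recovered γ t (inbox p) d fun i =>
      (answer X (roundQuery γ t (inbox p) r) i).getD false) =
    restrictTo (d - t) (mask (d - t) r) X := by
  funext i
  simp only [restrictTo]
  split_ifs with hi
  swap
  · rfl
  cases t with
  | zero =>
    have hi' : label d i = r := by simpa [mask_self] using hi
    simp [recovered, answer, roundQuery, hi']
  | succ t =>
    simp only [recovered]
    set w := mask (d - t) (label d i) with hw
    have hwm : mask (d - t) w = w := mask_mask_of_le le_rfl _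
    rw [resolve_eq (x := restrictTo (d - t) w X)]
    · simp [restrictTo, ← hw]
    · simp only [candidates, mem_filter, mem_univ, true_and]
      exact ⟨restrictTo_restrictTo _ _ _, h w hwm p⟩
    · intro j hj
      have hjq : j ∈ roundQuery γ (t + 1) (inbox p) r := by
        simp only [roundQuery, mem_biUnion, mem_filter, mem_univ, true_and]
        refine ⟨w, ?_, hj⟩
        rw [hw, mask_mask_of_le (by omega), hi]
      simp [restrictTo, answer, hjq]

/-! ### Averaging over random bits, and concentration -/

theorem sum_fin_succ_pi {A : Type*} [Fintype A] (T : ℕ) (f : (Fin (T + 1) → A) → ℝ) :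
    ∑ ω, f ω = ∑ h : Fin T → A, ∑ a, f (Fin.snoc h a) := by
  rw [← (Fin.snocEquiv fun _ : Fin (T + 1) => A).sum_comp, Fintype.sum_prod_type_right]
  rfl

theorem sum_apply_eq {ι B : Type*} [Fintype ι] [DecidableEq ι] [Fintype B] (p : ι) (f : B → ℝ) :
    (∑ a : ι → B, f (a p)) * Fintype.card B = Fintype.card (ι → B) * ∑ r, f r := by
  rw [← (Equiv.funSplitAt p B).symm.sum_comp, Fintype.card_congr (Equiv.funSplitAt p B),
    Fintype.sum_prod_type, Fintype.card_prod]
  simp only [Equiv.funSplitAt, Equiv.piSplitAt_symm_apply, dite_true, sum_const, card_univ,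
    nsmul_eq_mul, ← mul_sum]
  push_cast
  ring

/-- A lower tail bound for the number of successes among independent uniform choices. -/
theorem card_few_hits_le {ι B : Type*} [Fintype ι] [DecidableEq ι] [Fintype B] [DecidableEq B]
    [Nonempty B] (H : Finset B) (G : Finset ι) (μ : ℝ)
    (hμ : μ ≤ G.card * (H.card / Fintype.card B)) :
    ((univ.filter fun a : ι → B => ((G.filter fun p => a p ∈ H).card : ℝ) < μ / 2).card : ℝ) ≤
      Real.exp (-(3 / 20 * μ)) * Fintype.card (ι → B) := by
  have hN : (0 : ℝ) < Fintype.card B := by exact_mod_cast Fintype.card_pos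
  -- Each hit contributes a factor `1 / 2`: this is the exponential moment method, with the
  -- expectation factoring over `ι`.
  set w : ι → B → ℝ := fun p b => if p ∈ G ∧ b ∈ H then 1 / 2 else 1 with hw
  have hprod : ∀ a : ι → B, ∏ p, w p (a p) = (1 / 2 : ℝ) ^ (G.filter fun p => a p ∈ H).card := by
    intro a
    simp only [hw]
    rw [prod_ite, prod_const, prod_const_one, mul_one]
    congr 2
    ext p; simp
  have hsum : ∑ a : ι → B, ∏ p, w p (a p) = ∏ p, ∑ b, w p b := by
    rw [prod_univ_sum, Fintype.piFinset_univ]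
  have hrow : ∀ p, ∑ b, w p b =
      Fintype.card B * (if p ∈ G then 1 - (H.card : ℝ) / Fintype.card B / 2 else 1) := by
    intro p
    by_cases hp : p ∈ G
    · have : ∀ b, w p b = 1 - (if b ∈ H then 1 / 2 else 0) := by
        intro b; simp only [hw, hp, true_and]; split_ifs <;> norm_num
      simp only [this, sum_sub_distrib, hp, if_true]
      rw [← sum_filter]
      simp
      field_simp
    · simp [hw, hp]
  have htot : ∑ a : ι → B, (1 / 2 : ℝ) ^ (G.filter fun p => a p ∈ H).card ≤
      Fintype.card (ι → B) * Real.exp (-(μ / 2)) := by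
    simp only [← hprod]
    rw [hsum, prod_congr rfl fun p _ => hrow p, prod_mul_distrib, prod_const, card_univ,
      Fintype.card_fun, prod_ite, prod_const_one, mul_one, prod_const]
    push_cast
    gcongr
    have hle : (H.card : ℝ) / Fintype.card B ≤ 1 := by
      rw [div_le_one hN]; exact_mod_cast card_le_univ H
    have h1 : 1 - (H.card : ℝ) / Fintype.card B / 2 ≤
        Real.exp (-(H.card / Fintype.card B / 2)) := by
      have := Real.add_one_le_exp (-((H.card : ℝ) / Fintype.card B / 2)); linarith
    have hf : univ.filter (fun p => p ∈ G) = G := by ext; simp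
    rw [hf]
    calc _ ≤ (Real.exp (-(H.card / Fintype.card B / 2))) ^ G.card :=
          pow_le_pow_left₀ (by linarith) h1 _
      _ = Real.exp (-(G.card * (H.card / Fintype.card B) / 2)) := by
          rw [← Real.exp_nat_mul]; congr 1; ring
      _ ≤ _ := Real.exp_le_exp.mpr (by linarith)
  have hmarkov : ((univ.filter fun a : ι → B =>
      ((G.filter fun p => a p ∈ H).card : ℝ) < μ / 2).card : ℝ) *
      Real.exp (-(Real.log 2 * (μ / 2))) ≤
      ∑ a : ι → B, (1 / 2 : ℝ) ^ (G.filter fun p => a p ∈ H).card := by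
    rw [← nsmul_eq_mul, ← sum_const]
    refine (sum_le_sum fun a ha => ?_).trans
      (sum_le_sum_of_subset_of_nonneg (subset_univ _) fun _ _ _ => by positivity)
    have ha := (mem_filter.mp ha).2
    have : (1 / 2 : ℝ) = Real.exp (-Real.log 2) := by
      rw [Real.exp_neg, Real.exp_log two_pos]; norm_num
    rw [this, ← Real.exp_nat_mul]
    apply Real.exp_le_exp.mpr
    have := mul_le_mul_of_nonneg_left ha.le (Real.log_pos one_lt_two).le
    linarith
  by_cases hμ0 : 0 ≤ μ
  · have h := hmarkov.trans htot
    rw [← le_div_iff₀ (Real.exp_pos _), mul_div_assoc, ← Real.exp_sub] at h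
    refine h.trans ?_
    rw [mul_comm]
    gcongr
    -- The exponent is `-(1 - log 2) / 2 * μ`, and `(1 - log 2) / 2 > 3 / 20`.
    have := mul_le_mul_of_nonneg_right Real.log_two_lt_d9.le hμ0
    linarith
  · have : (univ.filter fun a : ι → B =>
        ((G.filter fun p => a p ∈ H).card : ℝ) < μ / 2) = ∅ := by
      ext a
      simp only [mem_filter, mem_univ, true_and, notMem_empty, iff_false, not_lt]
      have : (0 : ℝ) ≤ (G.filter fun p => a p ∈ H).card := by positivity
      linarith
    rw [this]
    simp
    positivity

/-- Each segment of level `m` is chosen by about its share of the peers outside `B`. -/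
def Covered (γ : ℝ) (m : ℕ) (B : Finset (Fin k)) (a : Fin k → Fin d → Bool) : Prop :=
  ∀ v : Fin d → Bool, mask m v = v →
    γ * k / 2 ^ (m + 1) ≤ ((Bᶜ.filter fun p => mask m (a p) = v).card : ℝ)

open Classical in
theorem card_not_covered_le {γ : ℝ} {m : ℕ} (hm : m ≤ d) {B : Finset (Fin k)}
    (hB : (B.card : ℝ) ≤ (1 - γ) * k) :
    ((univ.filter fun a : Fin k → Fin d → Bool => ¬ Covered γ m B a).card : ℝ) ≤
      2 ^ d * Real.exp (-(3 / 20 * (γ * k / 2 ^ m))) * Fintype.card (Fin k → Fin d → Bool) := by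
  set E : (Fin d → Bool) → Finset (Fin k → Fin d → Bool) := fun v => univ.filter fun a =>
    mask m v = v ∧ ((Bᶜ.filter fun p => mask m (a p) = v).card : ℝ) < γ * k / 2 ^ (m + 1)
  have hsub : (univ.filter fun a : Fin k → Fin d → Bool => ¬ Covered γ m B a) ⊆
      univ.biUnion E := by
    intro a ha
    have ha := (mem_filter.mp ha).2
    simp only [Covered] at ha
    push Not at ha
    obtain ⟨v, hv, h⟩ := ha
    simp only [E, mem_biUnion, mem_univ, true_and, mem_filter]
    exact ⟨v, hv, h⟩
  have hE : ∀ v, ((E v).card : ℝ) ≤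
      Real.exp (-(3 / 20 * (γ * k / 2 ^ m))) * Fintype.card (Fin k → Fin d → Bool) := by
    intro v
    by_cases hv : mask m v = v
    · have hcard : ((univ.filter fun r : Fin d → Bool => mask m r = v).card : ℝ) /
          Fintype.card (Fin d → Bool) = 1 / 2 ^ m := by
        rw [card_filter_mask_eq hm hv]
        simp only [Fintype.card_fun, Fintype.card_bool, Fintype.card_fin]
        push_cast
        rw [div_eq_div_iff (by positivity) (by positivity), ← pow_add, one_mul,
          Nat.sub_add_cancel hm]
      have hG : γ * k ≤ (Bᶜ.card : ℝ) := by
        rw [card_compl, Fintype.card_fin, Nat.cast_sub (by simpa using card_le_univ B)]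
        linarith
      have := card_few_hits_le (univ.filter fun r : Fin d → Bool => mask m r = v) Bᶜ
        (γ * k / 2 ^ m) (by
          rw [hcard, mul_one_div]
          gcongr)
      refine le_trans ?_ this
      apply Nat.cast_le.mpr
      apply card_le_card
      intro a ha
      have ha := (mem_filter.mp ha).2.2
      simp only [mem_filter, mem_univ, true_and]
      rwa [div_div, ← pow_succ]
    · have : E v = ∅ := by ext a; simp [E, hv]
      rw [this]; simp; positivity
  calc _ ≤ ((univ.biUnion E).card : ℝ) := by exact_mod_cast card_le_card hsub
    _ ≤ ∑ v, ((E v).card : ℝ) := by exact_mod_cast card_biUnion_le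
    _ ≤ _ := (sum_le_sum fun v _ => hE v).trans (by simp [mul_assoc])

/-- The expected number of queries in a round after the first. -/
theorem sum_card_roundQuery_le {γ : ℝ} (hγ : 0 < γ) (hk : 0 < k) {t : ℕ} (ht : t < d)
    (inb : Fin k → Msg) :
    ∑ r : Fin d → Bool, ((roundQuery (n := n) γ (t + 1) inb r).card : ℝ) ≤ 2 ^ d * (4 / γ) := by
  set S : (Fin d → Bool) → Finset (Fin n → Bool) :=
    candidates (d - t) (γ * k / 2 ^ (d - t + 1)) inb
  have h₁ : ∀ r, ((roundQuery (n := n) γ (t + 1) inb r).card : ℝ) ≤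
      ∑ v, if mask (d - (t + 1)) r = mask (d - (t + 1)) v then ((S v).card : ℝ) else 0 := by
    intro r
    rw [← sum_filter]
    have := (card_biUnion_le (s := univ.filter fun v : Fin d → Bool =>
      mask (d - (t + 1)) r = mask (d - (t + 1)) v) (t := fun v => separator (S v))).trans
      (sum_le_sum fun v _ => card_separator_le (S v))
    exact_mod_cast this
  refine (sum_le_sum fun r _ => h₁ r).trans ?_
  rw [sum_comm]
  have h₂ : ∀ v : Fin d → Bool, (∑ r : Fin d → Bool,
      if mask (d - (t + 1)) r = mask (d - (t + 1)) v then ((S v).card : ℝ) else 0) =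
      2 ^ (t + 1) * (S v).card := by
    intro v
    rw [← sum_filter, sum_const, card_filter_mask_eq (by omega) (mask_mask_of_le le_rfl _),
      nsmul_eq_mul, show d - (d - (t + 1)) = t + 1 by omega]
    push_cast; rfl
  rw [sum_congr rfl fun v _ => h₂ v, ← mul_sum]
  have h₃ := sum_card_candidates_mul_le (n := n) (d := d) (d - t) (γ * k / 2 ^ (d - t + 1)) inb
  have hk' : (0 : ℝ) < k := by exact_mod_cast hk
  rw [← le_div_iff₀ (by positivity)] at h₃
  calc _ ≤ (2 : ℝ) ^ (t + 1) * (k / (γ * k / 2 ^ (d - t + 1))) := by gcongr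
    _ = 2 ^ (t + 1 + (d - t + 1)) / γ := by rw [pow_add _ (t + 1)]; field_simp
    -- The factor 4 is one 2 from halving the expected support and one 2 from the two subsegments.
    _ = _ := by rw [show t + 1 + (d - t + 1) = d + 2 by omega, pow_add]; ring

/-! ### Executions, round by round -/

theorem exec_snoc (P : Protocol n k) {β : ℝ} (X : Fin n → Bool) (Adv : Adversary P β) (t : ℕ)
    (h : P.Coins t) (a : Fin k → Fin P.numBits → Bool) :
    exec P X Adv (t + 1) (Fin.snoc h a : P.Coins (t + 1)) =
      (exec P X Adv t h).step X t (Adv.corrupt t h) a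
        (Adv.send t (Fin.snoc h a : P.Coins (t + 1)))
        (Adv.newState t (Fin.snoc h a : P.Coins (t + 1))) := by
  rw [exec, Fin.init_snoc, Fin.snoc_last]

theorem card_coins_succ (P : Protocol n k) (t : ℕ) : (Fintype.card (P.Coins (t + 1)) : ℝ) =
    Fintype.card (Fin k → Fin P.numBits → Bool) * Fintype.card (P.Coins t) := by
  rw [Fintype.card_fun, Fintype.card_fun (α := Fin t)]
  simp only [Fintype.card_fin]
  push_cast
  ring

/-- Nonfaulty peers that chose `v` send its true content to everyone, so coverage becomes support;
messages of faulty peers cannot remove it. -/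
theorem supported_step {γ : ℝ} {X : Fin n → Bool} {t : ℕ} {c : Config (download n k d γ)}
    (hc : Supported d γ X c.inbox t) {B : Finset (Fin k)} {a : Fin k → Fin d → Bool}
    (ha : Covered γ (d - t) B a) (badMsg : Fin k → Fin k → Msg)
    (badState : Fin k → (download n k d γ).State) :
    Supported d γ X (c.step X t B a badMsg badState).inbox (t + 1) := by
  intro v hv q
  refine (ha v hv).trans (Nat.cast_le.mpr (card_le_card ?_))
  intro p hp
  simp only [mem_filter, mem_compl] at hp
  rw [mem_filter]
  refine ⟨mem_univ _, ?_⟩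
  simp only [Config.step, hp.1, if_false]
  rw [restrictTo_recovered hc, hp.2]

-- Given the earlier bits, the inboxes and the faulty set are fixed while the new bits are uniform.
-- Each round thus adds at most `ε` to the failure probability.
open Classical in
theorem sum_not_supported_le {γ ε : ℝ} (X : Fin n → Bool)
    (Adv : Adversary (download n k d γ) (1 - γ))
    (hε : ∀ t < d, 2 ^ d * Real.exp (-(3 / 20 * (γ * k / 2 ^ (d - t)))) ≤ ε) (t : ℕ) (ht : t ≤ d) :
    ∑ ω : (download n k d γ).Coins t,
      (if Supported d γ X (exec _ X Adv t ω).inbox t then (0 : ℝ) else 1) ≤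
      t * ε * Fintype.card ((download n k d γ).Coins t) := by
  induction t with
  | zero => simp [Supported]
  | succ t ih =>
    have ih := ih (by omega)
    rw [sum_fin_succ_pi]
    have hstep : ∀ h : (download n k d γ).Coins t,
        ∑ a : Fin k → Fin d → Bool, (if Supported d γ X (exec _ X Adv (t + 1)
          (Fin.snoc h a : (download n k d γ).Coins (t + 1))).inbox (t + 1) then (0 : ℝ) else 1) ≤
        Fintype.card (Fin k → Fin d → Bool) *
          ((if Supported d γ X (exec _ X Adv t h).inbox t then (0 : ℝ) else 1) + ε) := by
      intro h
      have hε0 : 0 ≤ ε := le_trans (by positivity) (hε t (by omega))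
      by_cases hs : Supported d γ X (exec _ X Adv t h).inbox t
      · rw [if_pos hs, zero_add]
        have hcov := card_not_covered_le (d := d) (γ := γ) (m := d - t) (Nat.sub_le _ _)
          (Adv.card_corrupt_le t h)
        refine le_trans ?_ ((hcov.trans (mul_le_mul_of_nonneg_right (hε t (by omega))
          (Nat.cast_nonneg _))).trans_eq (mul_comm _ _))
        rw [← sum_boole]
        refine sum_le_sum fun a _ => ?_
        by_cases ha : Covered γ (d - t) (Adv.corrupt t h) a
        · rw [exec_snoc, if_pos (supported_step hs ha _ _)]
          split_ifs; simp
        · rw [if_pos ha]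
          split_ifs <;> simp
      · rw [if_neg hs]
        have : ∀ a ∈ (univ : Finset (Fin k → Fin d → Bool)),
            (if Supported d γ X (exec _ X Adv (t + 1)
              (Fin.snoc h a : (download n k d γ).Coins (t + 1))).inbox (t + 1)
              then (0 : ℝ) else 1) ≤ 1 + ε := by
          intro a _
          split_ifs <;> linarith
        refine (sum_le_sum this).trans ?_
        rw [sum_const, nsmul_eq_mul, card_univ]
    refine (sum_le_sum fun h _ => hstep h).trans ?_
    rw [← mul_sum, sum_add_distrib, sum_const, card_univ, nsmul_eq_mul]
    rw [card_coins_succ]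
    push_cast
    have := mul_le_mul_of_nonneg_left ih
      (Nat.cast_nonneg (α := ℝ) (Fintype.card (Fin k → Fin d → Bool)))
    linarith

/-- The last round is at level 0, whose single segment is the whole source. It needs no coverage, so
its random bits are arbitrary. -/
theorem succeeds_of_supported {γ β : ℝ} {X : Fin n → Bool} {Adv : Adversary (download n k d γ) β}
    {h : (download n k d γ).Coins d} (hs : Supported d γ X (exec _ X Adv d h).inbox d)
    (a : Fin k → Fin d → Bool) :
    Succeeds (download n k d γ) X Adv (Fin.snoc h a : (download n k d γ).Coins (d + 1)) := by
  intro p hp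
  have hf : final (download n k d γ) X Adv (Fin.snoc h a : (download n k d γ).Coins (d + 1)) = _ :=
    exec_snoc (download n k d γ) X Adv d h a
  rw [hf] at hp ⊢
  have hp : p ∉ Adv.corrupt d h := hp
  have := restrictTo_recovered hs p (a p)
  simp only [Config.step, hp, if_false, download]
  refine this.trans ?_
  funext i
  simp [restrictTo, mask_zero (label d i) (a p)]

theorem le_successProb {γ ε : ℝ} (X : Fin n → Bool) (Adv : Adversary (download n k d γ) (1 - γ))
    (hε : ∀ t < d, 2 ^ d * Real.exp (-(3 / 20 * (γ * k / 2 ^ (d - t)))) ≤ ε) :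
    1 - d * ε ≤ successProb (download n k d γ) X Adv := by
  classical
  have hpos : (0 : ℝ) < Nat.card ((download n k d γ).Coins (download n k d γ).rounds) := by
    exact_mod_cast Nat.card_pos
  rw [successProb, le_div_iff₀ hpos]
  have hcard : (Nat.card ((download n k d γ).Coins (download n k d γ).rounds) : ℝ) =
      Fintype.card ((download n k d γ).Coins d) * Fintype.card (Fin k → Fin d → Bool) := by
    rw [Nat.card_eq_fintype_card, mul_comm]
    exact card_coins_succ (download n k d γ) d
  have hfail := sum_not_supported_le X Adv hε d le_rfl
  have hsucc : ∑ h : (download n k d γ).Coins d, ∑ _a : Fin k → Fin d → Bool,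
      (1 - if Supported d γ X (exec _ X Adv d h).inbox d then (0 : ℝ) else 1) ≤
      Nat.card {ω // Succeeds (download n k d γ) X Adv ω} := by
    rw [Nat.card_eq_fintype_card, Fintype.card_subtype, ← sum_boole]
    refine le_trans (sum_le_sum fun h _ => sum_le_sum fun a _ => ?_)
      (sum_fin_succ_pi (A := Fin k → Fin d → Bool) d _).symm.le
    by_cases hs : Supported d γ X (exec _ X Adv d h).inbox d
    · rw [if_pos hs, if_pos (succeeds_of_supported hs a)]; simp
    · rw [if_neg hs]; split_ifs <;> simp
  refine le_trans ?_ hsucc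
  simp only [sum_const, card_univ, nsmul_eq_mul]
  rw [← mul_sum, sum_sub_distrib, sum_const, card_univ, nsmul_eq_mul, hcard]
  have := mul_le_mul_of_nonneg_left hfail
    (Nat.cast_nonneg (α := ℝ) (Fintype.card (Fin k → Fin d → Bool)))
  linarith

/-- The bits of a round are independent of the inbox at its start, so the bound for an arbitrary
inbox can be averaged over the history. -/
theorem sum_queries_le {γ β : ℝ} (hγ : 0 < γ) (hk : 0 < k) (X : Fin n → Bool)
    (Adv : Adversary (download n k d γ) β) (p : Fin k) (t : ℕ) (ht : t ≤ d) :
    ∑ ω : (download n k d γ).Coins (t + 1), ((exec _ X Adv (t + 1) ω).queries p : ℝ) ≤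
      (n / 2 ^ d + 1 + t * (4 / γ)) * Fintype.card ((download n k d γ).Coins (t + 1)) := by
  have hround : ∀ (t : ℕ) (h : (download n k d γ).Coins t) (a : Fin k → Fin d → Bool),
      ((exec _ X Adv (t + 1) (Fin.snoc h a : (download n k d γ).Coins (t + 1))).queries p : ℝ) ≤
      (exec _ X Adv t h).queries p +
        (roundQuery (n := n) γ t ((exec _ X Adv t h).inbox p) (a p)).card := by
    intro t h a
    rw [exec_snoc]
    simp only [Config.step]
    split_ifs
    · simp
    · push_cast; rfl
  induction t with
  | zero =>
    rw [sum_fin_succ_pi]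
    have : ∀ (h : (download n k d γ).Coins 0) (a : Fin k → Fin d → Bool),
        ((exec _ X Adv 1 (Fin.snoc h a : (download n k d γ).Coins 1)).queries p : ℝ) ≤
          n / 2 ^ d + 1 := by
      intro h a
      refine (hround 0 h a).trans ?_
      simp only [exec, Config.initial, Nat.cast_zero, zero_add, roundQuery]
      refine (Nat.cast_le.mpr (card_filter_label_le (a p))).trans ?_
      push_cast
      gcongr
      exact_mod_cast Nat.cast_div_le (α := ℝ) (m := n) (n := 2 ^ d)
    refine (sum_le_sum fun h _ => sum_le_sum fun a _ => this h a).trans ?_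
    rw [card_coins_succ]
    simp only [sum_const, card_univ, nsmul_eq_mul]
    push_cast
    apply le_of_eq
    ring
  | succ t ih =>
    have ih := ih (by omega)
    rw [sum_fin_succ_pi]
    have hstep : ∀ h : (download n k d γ).Coins (t + 1), ∑ a : Fin k → Fin d → Bool,
        ((exec _ X Adv (t + 1 + 1)
          (Fin.snoc h a : (download n k d γ).Coins (t + 1 + 1))).queries p : ℝ) ≤
        Fintype.card (Fin k → Fin d → Bool) * ((exec _ X Adv (t + 1) h).queries p + 4 / γ) := by
      intro h
      refine (sum_le_sum fun a _ => hround (t + 1) h a).trans ?_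
      rw [sum_add_distrib, sum_const, card_univ, nsmul_eq_mul, mul_add]
      gcongr
      have h₁ := sum_apply_eq p fun r : Fin d → Bool =>
        ((roundQuery (n := n) γ (t + 1) ((exec _ X Adv (t + 1) h).inbox p) r).card : ℝ)
      have h₂ := sum_card_roundQuery_le (n := n) hγ hk (show t < d by omega)
        ((exec _ X Adv (t + 1) h).inbox p)
      have h₃ : (Fintype.card (Fin d → Bool) : ℝ) = 2 ^ d := by simp
      rw [h₃] at h₁
      refine le_of_mul_le_mul_right (h₁.trans_le ?_) (by positivity : (0 : ℝ) < 2 ^ d)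
      refine (mul_le_mul_of_nonneg_left h₂ (Nat.cast_nonneg _)).trans_eq (by ring)
    refine (sum_le_sum fun h _ => hstep h).trans ?_
    rw [← mul_sum, sum_add_distrib, sum_const, card_univ, nsmul_eq_mul]
    rw [card_coins_succ _ (t + 1)]
    push_cast
    have := mul_le_mul_of_nonneg_left ih
      (Nat.cast_nonneg (α := ℝ) (Fintype.card (Fin k → Fin d → Bool)))
    linarith

theorem expectedQueries_le {γ β : ℝ} (hγ : 0 < γ) (hk : 0 < k) (X : Fin n → Bool)
    (Adv : Adversary (download n k d γ) β) (p : Fin k) :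
    expectedQueries (download n k d γ) X Adv p ≤ n / 2 ^ d + 1 + d * (4 / γ) := by
  have hpos : (0 : ℝ) < Nat.card ((download n k d γ).Coins (download n k d γ).rounds) := by
    exact_mod_cast Nat.card_pos
  rw [expectedQueries, div_le_iff₀ hpos, Nat.card_eq_fintype_card]
  exact sum_queries_le hγ hk X Adv p d le_rfl

theorem msgSize_exec_le {γ β : ℝ} (X : Fin n → Bool) (Adv : Adversary (download n k d γ) β)
    (t : ℕ) (ω : (download n k d γ).Coins t) : (exec _ X Adv t ω).msgSize ≤ d + n := by
  induction t with
  | zero => simp [exec, Config.initial]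
  | succ t ih =>
    simp only [exec, Config.step]
    refine max_le (ih _) (Finset.sup_le fun p _ => Finset.sup_le fun q _ => ?_)
    exact (length_encode _ _).le

/-! ### Choice of parameters -/

/-- The number of levels: the lowest segments are so large that each of them is chosen by
sufficiently many nonfaulty peers. -/
theorem exists_levels {n k : ℕ} {γ K : ℝ} (hn : 2 ≤ n) (hk : 1 ≤ k) (hkn : k ≤ n) (hγ : 0 < γ)
    (hγ1 : γ ≤ 1) (hK : 2 ≤ K) :
    ∃ d : ℕ, 2 ^ d ≤ n ∧ (d = 0 ∨ K * Real.log n ≤ γ * k / 2 ^ d) ∧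
      (n : ℝ) / 2 ^ d ≤ 2 * K * (n / (γ * k)) * Real.log n := by
  have hlog : 1 / 2 < Real.log n :=
    (by linarith [Real.log_two_gt_d9] : (1 / 2 : ℝ) < Real.log 2).trans_le
      (Real.log_le_log two_pos (by exact_mod_cast hn))
  have hk' : (0 : ℝ) < k := by exact_mod_cast hk
  have hn' : (0 : ℝ) < n := by positivity
  have hKl : 1 ≤ K * Real.log n := by nlinarith
  set ρ : ℝ := γ * k / (K * Real.log n) with hρ
  have hρ0 : 0 ≤ ρ := by positivity
  have hρn : ρ ≤ n := by
    rw [hρ, div_le_iff₀ (by linarith)]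
    have : (k : ℝ) ≤ n := by exact_mod_cast hkn
    nlinarith
  have hlt : ρ < 2 ^ (Nat.log 2 ⌊ρ⌋₊ + 1) := by
    have h := Nat.lt_pow_succ_log_self one_lt_two ⌊ρ⌋₊
    exact_mod_cast (Nat.floor_lt hρ0).mp h
  -- If `ρ < 1`, the convention `Nat.log 2 0 = 0` gives `d = 0`, and each peer reads everything.
  refine ⟨Nat.log 2 ⌊ρ⌋₊, ?_, ?_, ?_⟩
  · by_cases h0 : ⌊ρ⌋₊ = 0
    · rw [h0]; simp; omega
    · exact (Nat.pow_log_le_self 2 h0).trans (Nat.floor_le_of_le hρn)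
  · by_cases h0 : ⌊ρ⌋₊ = 0
    · left; rw [h0]; simp
    · right
      have h : ((2 ^ Nat.log 2 ⌊ρ⌋₊ : ℕ) : ℝ) ≤ ρ :=
        (Nat.cast_le.mpr (Nat.pow_log_le_self 2 h0)).trans (Nat.floor_le hρ0)
      push_cast at h
      rw [le_div_iff₀ (by positivity)]
      rw [hρ, le_div_iff₀ (by linarith)] at h
      linarith
  · rw [div_le_iff₀ (by positivity)]
    rw [hρ, div_lt_iff₀ (by linarith), pow_succ] at hlt
    rw [show 2 * K * (n / (γ * k)) * Real.log n * 2 ^ Nat.log 2 ⌊ρ⌋₊ =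
      n * ((2 ^ Nat.log 2 ⌊ρ⌋₊ * 2 * (K * Real.log n)) / (γ * k)) by ring]
    refine le_mul_of_one_le_right hn'.le ?_
    rw [one_le_div (by positivity)]
    exact hlt.le

theorem two_pow_mul_exp_le {n d m : ℕ} {c x : ℝ} (hn : 1 ≤ n) (hd : 2 ^ d ≤ n) (hm : m ≤ d)
    (hx : 0 ≤ x) (h : 7 * (c + 2) * Real.log n ≤ x / 2 ^ d) (hc : 0 ≤ c) :
    2 ^ d * Real.exp (-(3 / 20 * (x / 2 ^ m))) ≤ (n : ℝ) ^ (-c) / n := by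
  have hn' : (0 : ℝ) < n := by exact_mod_cast hn
  have hlog : 0 ≤ Real.log n := Real.log_nonneg (by exact_mod_cast hn)
  have hxm : x / 2 ^ d ≤ x / 2 ^ m := by
    gcongr
    exact one_le_two
  have hexp : Real.exp (-(3 / 20 * (x / 2 ^ m))) ≤ (n : ℝ) ^ (-c - 2) := by
    rw [Real.rpow_def_of_pos hn']
    apply Real.exp_le_exp.mpr
    -- The constant 7 is large enough because `3 / 20 * 7 ≥ 1`.
    nlinarith [mul_nonneg (by linarith : 0 ≤ c + 2) hlog]
  calc _ ≤ (n : ℝ) * (n : ℝ) ^ (-c - 2) := by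
        gcongr
        exact_mod_cast hd
    _ = _ := by
        rw [Real.rpow_sub hn', Real.rpow_two]
        field_simp

end DataRetrieval

theorem mainTheorem4 (c : ℝ) (hc : 1 ≤ c) :
    ∃ C : ℝ, 0 < C ∧ ∀ (n k : ℕ) (β : ℝ), 2 ≤ n → 1 ≤ k → k ≤ n → 0 ≤ β → β < 1 →
      ∃ P : DataRetrieval.Protocol n k,
        (P.rounds : ℝ) ≤ C * Real.log n ∧
        ∀ (X : Fin n → Bool) (Adv : DataRetrieval.Adversary P β),
          1 - (n : ℝ) ^ (-c) ≤ DataRetrieval.successProb P X Adv ∧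
          (∀ p : Fin k, DataRetrieval.expectedQueries P X Adv p ≤
            C * (n / ((1 - β) * k)) * Real.log n) ∧
          ∀ ω : P.Coins P.rounds,
            ((DataRetrieval.final P X Adv ω).msgSize : ℝ) ≤ C * n := by
  -- With `K = 7 * (c + 2)`, the first round costs at most `2 * (n / 2 ^ d)`, which gives `4 * K`;
  -- the later ones cost `4 * d / γ` with `d ≤ 3 / 2 * log n`, which gives 6.
  refine ⟨4 * (7 * (c + 2)) + 6, by linarith, fun n k β hn hk hkn hβ hβ1 => ?_⟩
  obtain ⟨γ, rfl⟩ : ∃ γ, β = 1 - γ := ⟨1 - β, by ring⟩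
  have hγ : 0 < γ := by linarith
  rw [sub_sub_cancel]
  obtain ⟨d, hdn, hd, hseg⟩ := DataRetrieval.exists_levels (K := 7 * (c + 2)) hn hk hkn hγ
    (by linarith) (by linarith)
  have hn' : (0 : ℝ) < n := by positivity
  have hk' : (0 : ℝ) < k := by exact_mod_cast hk
  have hdn' : (2 : ℝ) ^ d ≤ n := by exact_mod_cast hdn
  have hlog2 : Real.log 2 ≤ Real.log n := Real.log_le_log two_pos (by exact_mod_cast hn)
  have hlog : 0 < Real.log n := (Real.log_pos one_lt_two).trans_le hlog2
  have hdlog : d * Real.log 2 ≤ Real.log n := by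
    rw [← Real.log_pow]
    exact Real.log_le_log (by positivity) hdn'
  have hd32 : d ≤ 3 / 2 * Real.log n := by
    nlinarith [Real.log_two_gt_d9, (Nat.cast_nonneg d : (0 : ℝ) ≤ d)]
  have hdle : (d : ℝ) ≤ n := by exact_mod_cast (Nat.lt_two_pow_self.le.trans hdn)
  refine ⟨DataRetrieval.download n k d γ, ?_, fun X Adv => ⟨?_, fun p => ?_, fun ω => ?_⟩⟩
  · have : ((DataRetrieval.download n k d γ).rounds : ℝ) = d + 1 := by
      simp
    rw [this]
    nlinarith [Real.log_two_gt_d9]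
  · have hε : ∀ t < d, 2 ^ d * Real.exp (-(3 / 20 * (γ * k / 2 ^ (d - t)))) ≤
        (n : ℝ) ^ (-c) / n := by
      intro t ht
      exact DataRetrieval.two_pow_mul_exp_le (by omega) hdn (Nat.sub_le _ _) (by positivity)
        (hd.resolve_left (by omega)) (by linarith)
    refine le_trans ?_ (DataRetrieval.le_successProb X Adv hε)
    have hpow : (0 : ℝ) < (n : ℝ) ^ (-c) := by positivity
    have : d * ((n : ℝ) ^ (-c) / n) ≤ (n : ℝ) ^ (-c) := by
      rw [mul_div_assoc', div_le_iff₀ hn', mul_comm]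
      gcongr
    linarith
  · refine (DataRetrieval.expectedQueries_le hγ hk X Adv p).trans ?_
    have h₁ : 1 ≤ (n : ℝ) / 2 ^ d := by rwa [one_le_div (by positivity)]
    have h₂ : 1 / γ ≤ (n : ℝ) / (γ * k) := by
      rw [div_le_div_iff₀ hγ (by positivity)]
      have : (k : ℝ) ≤ n := by exact_mod_cast hkn
      nlinarith
    have h₃ : d * (1 / γ) ≤ 3 / 2 * Real.log n * (n / (γ * k)) := by
      gcongr
    have h₄ : d * (4 / γ) = 4 * (d * (1 / γ)) := by ring
    rw [h₄]
    linarith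
  · have h := DataRetrieval.msgSize_exec_le X Adv _ ω
    have h : ((DataRetrieval.final _ X Adv ω).msgSize : ℝ) ≤ d + n := by exact_mod_cast h
    nlinarith
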